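/- Let $H=\ell^2(\mathbb N)$ be the complex Hilbert space of square-summable sequences, with standard basis $(e_i)_{i\ge 1}$, let $B(H)$ be the algebra of bounded operators on $H$, and let $K(H)$ be the ideal of compact operators. Let $T(\mathbb N)\subseteq B(H)$ be the algebra of all infinite upper triangular operators, i.e. the bounded operators that leave $\operatorname{span}\{e_1,\dots,e_n\}$ invariant for every $n\ge 1$, and let $QT(\mathbb N)=T(\mathbb N)+K(H)$ be the quasitriangular algebra. A two-sided ideal of a unital algebra $A$ is called left (resp. right) primitive if it is the annihilator of a simple left (resp. right) $A$-module, and $A$ is called left (resp. right) primitive if it has a faithful simple left (resp. right) module. Assume the Continuum Hypothesis. Then: 1. $T(\mathbb N)/(T(\mathbb N)\cap K(H))$ is both a left primitive and a right primitive algebra; 2. $QT(\mathbb N)/K(H)$ is both a left primitive and a right primitive algebra; 3. $K(H)$ is both a left primitive and a right primitive ideal of $QT(\mathbb N)$. -/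

import Mathlib

universe u

/-- `P` is a left primitive ideal of `R`: it is the annihilator of a simple left `R`-module.
(Every simple left module is isomorphic to `R ⧸ L` for a maximal left ideal `L`, so that modules
in the universe of `R` suffice.) -/
def IsLeftPrimitiveIdeal {R : Type u} [Ring R] (P : Ideal R) : Prop :=
  ∃ (M : Type u) (_ : AddCommGroup M) (_ : Module R M),
    IsSimpleModule R M ∧ ∀ r : R, r ∈ P ↔ ∀ m : M, r • m = 0

/-- `P` is a right primitive ideal of `R`: it is the annihilator of a simple right `R`-module.
Right `R`-modules are modules over the opposite ring, `MulOpposite.op r • m` being `m · r`. -/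
def IsRightPrimitiveIdeal {R : Type u} [Ring R] (P : Ideal R) : Prop :=
  ∃ (M : Type u) (_ : AddCommGroup M) (_ : Module Rᵐᵒᵖ M),
    IsSimpleModule Rᵐᵒᵖ M ∧ ∀ r : R, r ∈ P ↔ ∀ m : M, MulOpposite.op r • m = 0

/-- `R` is left primitive: it has a faithful simple left module. -/
def IsLeftPrimitiveRing (R : Type u) [Ring R] : Prop :=
  ∃ (M : Type u) (_ : AddCommGroup M) (_ : Module R M),
    IsSimpleModule R M ∧ FaithfulSMul R M

/-- `R` is right primitive: it has a faithful simple right module. -/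
def IsRightPrimitiveRing (R : Type u) [Ring R] : Prop :=
  ∃ (M : Type u) (_ : AddCommGroup M) (_ : Module Rᵐᵒᵖ M),
    IsSimpleModule Rᵐᵒᵖ M ∧ FaithfulSMul Rᵐᵒᵖ M

section Operators

variable {H : Type u} [NormedAddCommGroup H] [InnerProductSpace ℂ H]

/-- The algebra of all bounded operators that leave invariant the range of every member of `N`;
when `N` is a nest of projections, this is its nest algebra. -/
def nestAlgebra (N : Set (H →L[ℂ] H)) : Subalgebra ℂ (H →L[ℂ] H) where
  carrier := {T | ∀ P ∈ N, ∀ x ∈ P.range, T x ∈ P.range}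
  mul_mem' := fun hS hT P hP x hx => hS P hP _ (hT P hP x hx)
  add_mem' := fun hS hT P hP x hx => P.range.add_mem (hS P hP x hx) (hT P hP x hx)
  algebraMap_mem' := fun c P _ x hx => by
    simpa [Algebra.algebraMap_eq_smul_one] using P.range.smul_mem c hx

/-- The algebra `A + K(H)`, for an algebra `A` of bounded operators on `H`. -/
def addCompacts (A : Subalgebra ℂ (H →L[ℂ] H)) : Subalgebra ℂ (H →L[ℂ] H) where
  carrier := {X | ∃ T ∈ A, ∃ K : H →L[ℂ] H, IsCompactOperator K ∧ X = T + K}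
  mul_mem' := by
    rintro _ _ ⟨T, hT, K, hK, rfl⟩ ⟨S, hS, L, hL, rfl⟩
    refine ⟨T * S, A.mul_mem hT hS, T * L + K * (S + L), ?_, by noncomm_ring⟩
    exact (hL.clm_comp T).add (hK.comp_clm (S + L))
  add_mem' := by
    rintro _ _ ⟨T, hT, K, hK, rfl⟩ ⟨S, hS, L, hL, rfl⟩
    exact ⟨T + S, A.add_mem hT hS, K + L, hK.add hL, by abel⟩
  algebraMap_mem' := fun c =>
    ⟨algebraMap ℂ _ c, A.algebraMap_mem c, 0, isCompactOperator_zero, by simp⟩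

/-- The ideal `A ∩ K(H)` of compact operators in an algebra `A` of bounded operators. -/
def compactIdeal (A : Subalgebra ℂ (H →L[ℂ] H)) : Ideal A where
  carrier := {X | IsCompactOperator (X : H →L[ℂ] H)}
  add_mem' := fun hX hY => IsCompactOperator.add hX hY
  zero_mem' := isCompactOperator_zero
  smul_mem' := fun X _ hY => IsCompactOperator.clm_comp hY (X : H →L[ℂ] H)

instance compactIdeal_isTwoSided (A : Subalgebra ℂ (H →L[ℂ] H)) :
    (compactIdeal A).IsTwoSided where
  mul_mem_of_left Y hX := IsCompactOperator.comp_clm hX (Y : H →L[ℂ] H)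

/-- All compact operators lie in `A + K(H)`, so that `compactIdeal (addCompacts A)` consists of
all of `K(H)`. -/
theorem mem_addCompacts_of_isCompactOperator (A : Subalgebra ℂ (H →L[ℂ] H))
    {K : H →L[ℂ] H} (hK : IsCompactOperator K) : K ∈ addCompacts A :=
  ⟨0, A.zero_mem, K, hK, (zero_add K).symm⟩

end Operators

/-- The Hilbert space `ℓ²(ℕ)` of square-summable complex sequences. -/
abbrev EllTwo : Type := lp (fun _ : ℕ => ℂ) 2

/-- The linear span of the first `n` vectors of the standard basis of `ℓ²(ℕ)`. -/
noncomputable def firstSpan (n : ℕ) : Submodule ℂ EllTwo :=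
  Submodule.span ℂ (Set.range fun i : Fin n => (lp.single 2 (i : ℕ) (1 : ℂ) : EllTwo))

instance firstSpan_finiteDimensional (n : ℕ) : FiniteDimensional ℂ (firstSpan n) :=
  FiniteDimensional.span_of_finite ℂ (Set.finite_range _)

/-- The canonical nest on `ℓ²(ℕ)`: the orthogonal projections onto the spans of the first `n`
standard basis vectors, for `n = 0, 1, 2, …` (`n = 0` gives the projection `0`), together with
the identity. -/
noncomputable def standardNest : Set (EllTwo →L[ℂ] EllTwo) :=
  (Set.range fun n : ℕ => (firstSpan n).starProjection) ∪ {1}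

/-- The algebra `T(ℕ)` of infinite upper triangular operators. -/
noncomputable def upperTriangular : Subalgebra ℂ (EllTwo →L[ℂ] EllTwo) :=
  nestAlgebra standardNest

/-- The quasitriangular algebra `QT(ℕ) = T(ℕ) + K(ℓ²(ℕ))`. -/
noncomputable def quasitriangular : Subalgebra ℂ (EllTwo →L[ℂ] EllTwo) :=
  addCompacts upperTriangular

/-! It suffices to find a proper left ideal `L` that contains the compact operators and, for every
noncompact `a`, some `1 - x * a * y` with `x`, `y` upper triangular. If `m ⊇ L` is a maximal left
ideal, the simple module modulo `m` is annihilated by exactly the compacts: a noncompact annihilator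
`a` would give `a * y ∈ m`, hence `x * a * y ∈ m` and `1 ∈ m` (`exists_simple_module_annihilator`).

`L` consists of the operators tending to zero along a proper filter `vecFilter S` of unit vectors
escaping to infinity. The set `S` is built by transfinite recursion: under CH the noncompact
operators can be well-ordered with countable initial segments, so each stage treats one `a` and a
countable `S`, where sequences suffice (`exists_set_of_countable_extension`).

At a single stage (`exists_insert_neBot`), triangular operators can only move vectors towards lower
coordinates, so `x * a * y` cannot be made to fix given blocks `ξ i`. It can be made an approximate
backward shift `ξ (i + 1) ↦ ξ i`, and normalised sums over long runs of the `ξ i` are then almost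
fixed (`vecFilter_insert_neBot`). For right ideals the same argument is applied to adjoints, with
forward shifts. -/

open Filter Topology Cardinal
open scoped InnerProductSpace

/-! ### Coordinates, truncations and supports in `ℓ²(ℕ)`. -/

/-- The standard basis vectors of `ℓ²(ℕ)`. -/
noncomputable def stdVec (i : ℕ) : EllTwo := lp.single 2 i (1 : ℂ)

theorem inner_stdVec (i : ℕ) (v : EllTwo) : ⟪stdVec i, v⟫_ℂ = v i := by
  simp [stdVec, lp.inner_single_left]

theorem stdVec_apply (i j : ℕ) : stdVec i j = if j = i then 1 else 0 := by
  simp [stdVec, lp.single_apply, Pi.single_apply]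

/-- The projection of `ℓ²(ℕ)` onto its first `n` coordinates. -/
noncomputable def trunc (n : ℕ) : EllTwo →L[ℂ] EllTwo :=
  ∑ i ∈ Finset.range n, (innerSL ℂ (stdVec i)).smulRight (stdVec i)

theorem trunc_eq_sum (n : ℕ) (v : EllTwo) :
    trunc n v = ∑ i ∈ Finset.range n, v i • stdVec i := by
  simp [trunc, inner_stdVec]

theorem trunc_apply (n : ℕ) (v : EllTwo) (i : ℕ) :
    trunc n v i = if i < n then v i else 0 := by
  rw [trunc_eq_sum, lp.coeFn_sum, Finset.sum_apply]
  simp [stdVec_apply]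

theorem tendsto_trunc (v : EllTwo) : Tendsto (fun n => trunc n v) atTop (𝓝 v) := by
  have h := (lp.hasSum_single (p := 2) (by norm_num) v).tendsto_sum_nat
  refine h.congr fun n => ?_
  rw [trunc_eq_sum]
  refine Finset.sum_congr rfl fun i _ => ?_
  rw [stdVec, ← lp.single_smul]
  simp

theorem isCompactOperator_trunc (n : ℕ) : IsCompactOperator (trunc n) := by
  have h : trunc n ∈ compactOperator (RingHom.id ℂ) EllTwo EllTwo := by
    refine Submodule.sum_mem _ fun i _ => ?_
    have h1 : IsCompactOperator (innerSL ℂ (stdVec i)) :=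
      isCompactOperator_of_locallyCompactSpace_dom (innerSL ℂ (stdVec i))
    exact h1.clm_comp (ContinuousLinearMap.toSpanSingleton ℂ (stdVec i))
  exact h

/-- `SuppIn v n m` says that the coordinates of `v` outside `[n, m)` vanish. -/
def SuppIn (v : EllTwo) (n m : ℕ) : Prop := ∀ i, v i ≠ 0 → n ≤ i ∧ i < m

theorem SuppIn.mono {v : EllTwo} {n m n' m' : ℕ} (h : SuppIn v n m) (hn : n' ≤ n) (hm : m ≤ m') :
    SuppIn v n' m' :=
  fun i hi => ⟨hn.trans (h i hi).1, (h i hi).2.trans_le hm⟩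

theorem SuppIn.smul {v : EllTwo} {n m : ℕ} (h : SuppIn v n m) (c : ℂ) : SuppIn (c • v) n m :=
  fun i hi => h i fun h0 => hi (by simp [h0])

theorem SuppIn.sum {ι : Type*} {s : Finset ι} {v : ι → EllTwo} {n m : ℕ}
    (h : ∀ j ∈ s, SuppIn (v j) n m) : SuppIn (∑ j ∈ s, v j) n m := by
  intro i hi
  rw [lp.coeFn_sum, Finset.sum_apply] at hi
  obtain ⟨j, hj, hij⟩ := Finset.exists_ne_zero_of_sum_ne_zero hi
  exact h j hj i hij

theorem SuppIn.inner_eq_zero {u v : EllTwo} {a b c d : ℕ} (hu : SuppIn u a b) (hv : SuppIn v c d)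
    (h : b ≤ c) : ⟪u, v⟫_ℂ = 0 := by
  rw [lp.inner_eq_tsum]
  refine (tsum_congr fun i => ?_).trans tsum_zero
  by_cases hui : u i = 0
  · simp [hui]
  by_cases hvi : v i = 0
  · simp [hvi]
  have := (hu i hui).2
  have := (hv i hvi).1
  omega

theorem SuppIn.orthonormal {u : ℕ → EllTwo} {a b : ℕ → ℕ} (hu : ∀ i, SuppIn (u i) (a i) (b i))
    (hab : ∀ i j, i < j → b i ≤ a j) (h1 : ∀ i, ‖u i‖ = 1) : Orthonormal ℂ u := by
  refine ⟨h1, fun i j hij => ?_⟩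
  rcases lt_or_gt_of_ne hij with h | h
  · exact (hu i).inner_eq_zero (hu j) (hab i j h)
  · rw [← inner_conj_symm, (hu j).inner_eq_zero (hu i) (hab j i h), map_zero]

theorem suppIn_trunc_sub_trunc (v : EllTwo) {n m : ℕ} (h : n ≤ m) :
    SuppIn (trunc m v - trunc n v) n m := by
  intro i hi
  rw [lp.coeFn_sub, Pi.sub_apply, trunc_apply, trunc_apply] at hi
  by_contra hc
  apply hi
  split_ifs <;> first | simp; done | omega

/-! ### Filters of unit vectors escaping to infinity. -/

/-- The finitely supported unit vectors whose first `n` coordinates vanish. -/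
def tailUnit (n : ℕ) : Set EllTwo := {v | ‖v‖ = 1 ∧ ∃ m, SuppIn v n m}

/-- The filter of finitely supported unit vectors moving off to infinity along which all operators
in `S` tend to zero. -/
noncomputable def vecFilter (S : Set (EllTwo →L[ℂ] EllTwo)) : Filter EllTwo :=
  (⨅ n, 𝓟 (tailUnit n)) ⊓ ⨅ s : S, comap (fun v => (s : EllTwo →L[ℂ] EllTwo) v) (𝓝 0)

theorem tendsto_vecFilter_iff {ι : Type*} {l : Filter ι} {S : Set (EllTwo →L[ℂ] EllTwo)}
    {v : ι → EllTwo} : Tendsto v l (vecFilter S) ↔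
      (∀ n, ∀ᶠ i in l, v i ∈ tailUnit n) ∧ ∀ s ∈ S, Tendsto (fun i => s (v i)) l (𝓝 0) := by
  simp [vecFilter, tendsto_inf, tendsto_iInf, tendsto_principal, tendsto_comap_iff,
    Function.comp_def]

theorem vecFilter_tailUnit (S : Set (EllTwo →L[ℂ] EllTwo)) (n : ℕ) :
    ∀ᶠ v in vecFilter S, v ∈ tailUnit n :=
  (tendsto_vecFilter_iff.1 (tendsto_id (α := EllTwo))).1 n

theorem tendsto_apply_vecFilter {S : Set (EllTwo →L[ℂ] EllTwo)} {s : EllTwo →L[ℂ] EllTwo}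
    (hs : s ∈ S) : Tendsto (fun v => s v) (vecFilter S) (𝓝 0) :=
  (tendsto_vecFilter_iff.1 (tendsto_id (α := EllTwo))).2 s hs

theorem vecFilter_anti {S S' : Set (EllTwo →L[ℂ] EllTwo)} (h : S ⊆ S') :
    vecFilter S' ≤ vecFilter S :=
  tendsto_id'.1 <| tendsto_vecFilter_iff.2
    ⟨vecFilter_tailUnit S', fun _ hs => tendsto_apply_vecFilter (h hs)⟩

/-- This is where countability of each stage enters: it allows sequences and diagonal choices in
place of filters. -/
theorem isCountablyGenerated_vecFilter {S : Set (EllTwo →L[ℂ] EllTwo)} (hS : S.Countable) :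
    (vecFilter S).IsCountablyGenerated := by
  have := hS.to_subtype
  unfold vecFilter
  infer_instance

theorem stdVec_mem_tailUnit {n i : ℕ} (h : n ≤ i) : stdVec i ∈ tailUnit n := by
  refine ⟨by simp [stdVec], i + 1, fun j hj => ?_⟩
  have : j = i := by
    by_contra hne
    exact hj (by simp [stdVec_apply, hne])
  omega

theorem vecFilter_empty_neBot : (vecFilter ∅).NeBot := by
  have h : Tendsto stdVec atTop (vecFilter ∅) :=
    tendsto_vecFilter_iff.2 ⟨fun n => (eventually_ge_atTop n).mono fun i hi =>
      stdVec_mem_tailUnit hi, by simp⟩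
  exact h.neBot

/-- Membership in an infimum of filters involves only finitely many of them, so properness has
finite character in `S`. -/
theorem vecFilter_neBot_of_finite {S : Set (EllTwo →L[ℂ] EllTwo)}
    (h : ∀ F ⊆ S, F.Finite → (vecFilter F).NeBot) : (vecFilter S).NeBot := by
  rw [vecFilter, inf_neBot_iff]
  intro U hU V hV
  obtain ⟨t, ht⟩ := (mem_iInf_finite V).1 hV
  have hF := h (Subtype.val '' (t : Set S)) (by simp) (t.finite_toSet.image _)
  rw [vecFilter, inf_neBot_iff] at hF
  refine hF hU ?_
  refine mem_of_superset (?_ : _ ∈ _) (Set.Subset.refl V)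
  refine (le_iInf₂ fun s hs => ?_ : _ ≤ ⨅ i ∈ t, comap (fun v => (i : EllTwo →L[ℂ] EllTwo) v) (𝓝 0)) ht
  exact iInf_le_of_le (⟨s, s, hs, rfl⟩ : ↥(Subtype.val '' (t : Set S))) le_rfl

/-! ### Compactness as decay at infinity, along `vecFilter ∅`. -/

/-- Operators which are small on far away finitely supported unit vectors are compact. -/
theorem isCompactOperator_iff_tendsto {a : EllTwo →L[ℂ] EllTwo} :
    IsCompactOperator a ↔ Tendsto (fun v => a v) (vecFilter ∅) (𝓝 0) := by
  constructor
  · intro ha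
    have := isCountablyGenerated_vecFilter Set.countable_empty
    refine tendsto_of_subseq_tendsto fun v hv => ?_
    have hv' := (tendsto_vecFilter_iff.1 hv).1
    obtain ⟨K, hK, hKa⟩ := ha.image_closedBall_subset_compact (f := (a : EllTwo →ₗ[ℂ] EllTwo)) 1
    have hmem : ∃ᶠ n in atTop, a (v n) ∈ K := by
      refine Eventually.frequently ((hv' 0).mono fun n hn => hKa ⟨v n, ?_, rfl⟩)
      simpa using hn.1.le
    obtain ⟨w, hw, φ, hφ, hlim⟩ := hK.tendsto_subseq' hmem
    -- Vectors escaping to infinity tend weakly to zero; this forces the norm limit `w` of the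
    -- images to vanish.
    have hinner : ∀ z : EllTwo, Tendsto (fun n => ⟪z, v n⟫_ℂ) atTop (𝓝 0) := by
      intro z
      rw [Metric.tendsto_atTop']
      intro ε hε
      have h1 := (tendsto_trunc z).eventually (Metric.ball_mem_nhds z hε)
      obtain ⟨m, hm⟩ := h1.exists
      obtain ⟨N, hN⟩ := eventually_atTop.1 (hv' m)
      refine ⟨N, fun n hn => ?_⟩
      obtain ⟨hn1, q, hq⟩ := hN n hn.le
      have h0 : SuppIn (trunc m z) 0 m := fun i hi => by
        rw [trunc_apply] at hi
        by_contra hc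
        exact hi (if_neg (by omega))
      have h2 : ⟪z, v n⟫_ℂ = ⟪z - trunc m z, v n⟫_ℂ := by
        rw [inner_sub_left, h0.inner_eq_zero hq le_rfl, sub_zero]
      rw [dist_zero_right, h2]
      refine (norm_inner_le_norm _ _).trans_lt ?_
      rw [hn1, mul_one, ← dist_eq_norm, dist_comm]
      exact hm
    have hw0 : w = 0 := by
      have h1 : Tendsto (fun n => ⟪w, a (v (φ n))⟫_ℂ) atTop (𝓝 ⟪w, w⟫_ℂ) :=
        tendsto_const_nhds.inner hlim
      have h2 : Tendsto (fun n => ⟪w, a (v (φ n))⟫_ℂ) atTop (𝓝 0) := by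
        simp_rw [← ContinuousLinearMap.adjoint_inner_left]
        exact (hinner _).comp hφ.tendsto_atTop
      exact inner_self_eq_zero.1 (tendsto_nhds_unique h1 h2)
    exact ⟨φ, by simpa [hw0, Function.comp_def] using hlim⟩
  · intro h
    refine isCompactOperator_of_tendsto (l := atTop) (F := fun n => a * trunc n) ?_
      (Eventually.of_forall fun n => (isCompactOperator_trunc n).clm_comp a)
    rw [Metric.tendsto_atTop]
    intro ε hε
    have hev := h.eventually (Metric.ball_mem_nhds 0 (half_pos hε))
    have hb : (vecFilter ∅).HasBasis (fun _ : ℕ => True) tailUnit := by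
      have : vecFilter ∅ = ⨅ n, 𝓟 (tailUnit n) := by simp [vecFilter]
      rw [this]
      refine hasBasis_iInf_principal (directed_of_isDirected_le fun n m hnm v hv => ?_)
      exact ⟨hv.1, hv.2.imp fun q hq => hq.mono hnm le_rfl⟩
    obtain ⟨n, -, hn⟩ := hb.eventually_iff.1 hev
    refine ⟨n, fun m hm => ?_⟩
    rw [dist_comm, dist_eq_norm]
    refine (ContinuousLinearMap.opNorm_le_bound _ (half_pos hε).le fun v => ?_).trans_lt
      (half_lt_self hε)
    -- `tailUnit` has only finitely supported vectors, so the bound is first proved for `trunc q v`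
    -- and then passed to the limit in `q`.
    have hfin : ∀ q ≥ m, ‖a (trunc q v - trunc m v)‖ ≤ ε / 2 * ‖trunc q v - trunc m v‖ := by
      intro q hq
      set u := trunc q v - trunc m v with hu
      have hsupp : SuppIn u m q := suppIn_trunc_sub_trunc v hq
      by_cases h0 : u = 0
      · simp [h0]
      have hpos : 0 < ‖u‖ := norm_pos_iff.2 h0
      have hmem : ((‖u‖⁻¹ : ℝ) : ℂ) • u ∈ tailUnit n :=
        ⟨by rw [norm_smul]; simp [hpos.ne'], q, (hsupp.smul _).mono hm le_rfl⟩
      have := hn hmem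
      rw [dist_zero_right, map_smul, norm_smul] at this
      simp only [Complex.norm_real, norm_inv, norm_norm] at this
      rw [inv_mul_lt_iff₀ hpos] at this
      linarith
    have h1 := (tendsto_trunc v).sub_const (trunc m v)
    have h2 : ‖a (v - trunc m v)‖ ≤ ε / 2 * ‖v - trunc m v‖ :=
      le_of_tendsto_of_tendsto ((a.continuous.tendsto _).comp h1).norm (h1.norm.const_mul _)
        ((eventually_ge_atTop m).mono hfin)
    have h3 : ‖v - trunc m v‖ ≤ ‖v‖ := by
      refine lp.norm_mono (by norm_num) fun i => ?_
      rw [lp.coeFn_sub, Pi.sub_apply, trunc_apply]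
      split_ifs <;> simp
    simp only [sub_apply, mul_apply_eq_comp, ← map_sub]
    exact h2.trans (by gcongr)

/-! ### Triangularity by matrix entries, and partial isometries between blocks. -/

theorem mem_firstSpan_iff {n : ℕ} {v : EllTwo} : v ∈ firstSpan n ↔ SuppIn v 0 n := by
  constructor
  · intro hv i hi
    refine ⟨i.zero_le, ?_⟩
    by_contra hc
    refine hi ?_
    rw [firstSpan] at hv
    induction hv using Submodule.span_induction with
    | mem x hx =>
      obtain ⟨j, rfl⟩ := hx
      exact (stdVec_apply j i).trans (if_neg (by omega))
    | zero => simp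
    | add x y _ _ hx hy => simp_all
    | smul c x _ hx => simp_all
  · intro hv
    have h : v = trunc n v := by
      ext i
      rw [trunc_apply]
      split_ifs with hi
      · rfl
      · by_contra hc
        exact hi (hv i hc).2
    rw [h, trunc_eq_sum]
    refine Submodule.sum_mem _ fun i hi => Submodule.smul_mem _ _ (Submodule.subset_span ?_)
    exact ⟨⟨i, Finset.mem_range.1 hi⟩, rfl⟩

theorem mem_upperTriangular_of_apply_eq_zero {T : EllTwo →L[ℂ] EllTwo}
    (h : ∀ k i, k < i → T (stdVec k) i = 0) : T ∈ upperTriangular := by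
  rintro P (⟨n, rfl⟩ | rfl) x hx
  · have hr : ((firstSpan n).starProjection : EllTwo →ₗ[ℂ] EllTwo).range = firstSpan n :=
      Submodule.range_starProjection _
    change T x ∈ ((firstSpan n).starProjection : EllTwo →ₗ[ℂ] EllTwo).range
    change x ∈ ((firstSpan n).starProjection : EllTwo →ₗ[ℂ] EllTwo).range at hx
    rw [hr] at hx ⊢
    rw [firstSpan] at hx
    induction hx using Submodule.span_induction with
    | mem x hx =>
      obtain ⟨j, rfl⟩ := hx
      refine mem_firstSpan_iff.2 fun i hi => ⟨i.zero_le, ?_⟩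
      by_contra hc
      exact hi (h j i (by omega))
    | zero => simp
    | add x y _ _ hx hy => simpa using add_mem hx hy
    | smul c x _ hx => simpa using Submodule.smul_mem _ c hx
  · exact ⟨T x, rfl⟩

theorem adjoint_stdVec_apply (T : EllTwo →L[ℂ] EllTwo) (i k : ℕ) :
    T.adjoint (stdVec k) i = starRingEnd ℂ (T (stdVec i) k) := by
  rw [← inner_stdVec, ContinuousLinearMap.adjoint_inner_right, ← inner_stdVec, inner_conj_symm]

/-- The partial isometry which maps the orthonormal sequence `u` to the orthonormal sequence `w`. -/
theorem exists_partialIsometry {u w : ℕ → EllTwo} (hu : Orthonormal ℂ u) (hw : Orthonormal ℂ w) :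
    ∃ D : EllTwo →L[ℂ] EllTwo, (∀ j, D (u j) = w j) ∧
      ∀ i k, (∀ j, u j k = 0 ∨ w j i = 0) → D (stdVec k) i = 0 := by
  set U := hu.orthogonalFamily.linearIsometry with hU
  set W := hw.orthogonalFamily.linearIsometry with hW
  have hUe : ∀ j, U (stdVec j) = u j := fun j => by simp [hU, stdVec]
  have hWe : ∀ j, W (stdVec j) = w j := fun j => by simp [hW, stdVec]
  -- `U` and `W` are the isometries sending the standard basis to `u` and `w`, so `W U*` sends `u j`
  -- to `w j`.
  refine ⟨W.toContinuousLinearMap * U.toContinuousLinearMap.adjoint, fun j => ?_, fun i k h => ?_⟩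
  · rw [← hUe, ← hWe]
    refine congrArg W ?_
    refine ext_inner_left ℂ fun x => ?_
    exact (ContinuousLinearMap.adjoint_inner_right U.toContinuousLinearMap x _).trans
      (U.inner_map_map x (stdVec j))
  · have h1 := hw.orthogonalFamily.hasSum_linearIsometry (U.toContinuousLinearMap.adjoint (stdVec k))
    have h2 := (innerSL ℂ (stdVec i)).hasSum h1
    refine (inner_stdVec i _).symm.trans (h2.tsum_eq.symm.trans ?_)
    refine (tsum_congr fun j => ?_).trans tsum_zero
    have h4 : U.toContinuousLinearMap.adjoint (stdVec k) j = starRingEnd ℂ (u j k) := by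
      rw [← inner_stdVec, ContinuousLinearMap.adjoint_inner_right, ← inner_stdVec,
        inner_conj_symm]
      congr 1
      exact hUe j
    rcases h j with hj | hj <;> simp [h4, hj, inner_stdVec]

/-- Moving a block `u` to a block `w` on its left creates no matrix entry below the diagonal. -/
theorem SuppIn.eq_zero_or {u w : EllTwo} {a b c d i k : ℕ} (hu : SuppIn u c d) (hw : SuppIn w a b)
    (hbc : b ≤ c) (hik : k < i) : u k = 0 ∨ w i = 0 := by
  by_contra! h
  have := (hu k h.1).1
  have := (hw i h.2).2
  omega

/-! ### Block sequences extracted from a noncompact operator. -/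

/-- Noncompactness gives escaping unit vectors whose images stay away from zero; along a subsequence
the norms converge, so one scalar `d` serves all pairs. The head of `a ζ` is small because `trunc n
* a` is compact, its tail is cut off, and what remains is normalised to `η`. -/
theorem exists_unit_pair_of_not_isCompactOperator {a : EllTwo →L[ℂ] EllTwo}
    (ha : ¬ IsCompactOperator a) : ∃ d : ℝ, 0 < d ∧ ∀ ε > 0, ∀ n, ∃ m, n ≤ m ∧ ∃ ζ η : EllTwo,
      SuppIn ζ n m ∧ SuppIn η n m ∧ ‖ζ‖ = 1 ∧ ‖η‖ = 1 ∧ ‖a ζ - (d : ℂ) • η‖ ≤ ε := by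
  rw [isCompactOperator_iff_tendsto, Metric.tendsto_nhds] at ha
  push Not at ha
  obtain ⟨δ, hδ, hfreq⟩ := ha
  have := isCountablyGenerated_vecFilter Set.countable_empty
  obtain ⟨v, hv, hvδ⟩ := exists_seq_forall_of_frequently hfreq
  have hv1 := (tendsto_vecFilter_iff.1 hv).1
  have hbd : ∃ᶠ n in atTop, ‖a (v n)‖ ∈ Set.Icc δ ‖a‖ := by
    refine Eventually.frequently ((hv1 0).mono fun n hn => ⟨?_, ?_⟩)
    · simpa using hvδ n
    · simpa [hn.1] using a.le_opNorm (v n)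
  obtain ⟨d, hd, φ, hφ, hlim⟩ := isCompact_Icc.tendsto_subseq' hbd
  have hd0 : 0 < d := hδ.trans_le hd.1
  refine ⟨d, hd0, fun ε hε n => ?_⟩
  -- Cutting head and tail costs `2 * ε'` and replacing `‖w‖` by `d` costs `3 * ε'`; `4 * ε' ≤ d`
  -- keeps `w` nonzero.
  obtain ⟨ε', hε', hε1, hε2⟩ : ∃ ε' > 0, 5 * ε' ≤ ε ∧ 4 * ε' ≤ d :=
    ⟨min (ε / 5) (d / 4), by positivity, by linarith [min_le_left (ε / 5) (d / 4)],
      by linarith [min_le_right (ε / 5) (d / 4)]⟩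
  have hcomp : Tendsto (fun k => (trunc n * a) (v (φ k))) atTop (𝓝 0) :=
    (isCompactOperator_iff_tendsto.1 ((isCompactOperator_trunc n).comp_clm a)).comp
      (hv.comp hφ.tendsto_atTop)
  obtain ⟨k, hk1, hk2, hk3⟩ := ((hlim.eventually (Metric.ball_mem_nhds d hε')).and
    ((hcomp.eventually (Metric.ball_mem_nhds 0 hε')).and
      (hφ.tendsto_atTop.eventually (hv1 n)))).exists
  set ζ := v (φ k) with hζ
  obtain ⟨hζ1, q, hq⟩ := hk3
  obtain ⟨m, hm1, hm2⟩ := (((tendsto_trunc (a ζ)).eventually (Metric.ball_mem_nhds _ hε')).and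
    (eventually_ge_atTop (max q n))).exists
  set w := trunc m (a ζ) - trunc n (a ζ) with hw
  rw [Real.dist_eq] at hk1
  rw [dist_zero_right] at hk2
  rw [dist_comm, dist_eq_norm] at hm1
  have haw : ‖a ζ - w‖ ≤ 2 * ε' := by
    have : a ζ - w = (a ζ - trunc m (a ζ)) + trunc n (a ζ) := by rw [hw]; abel
    rw [this]
    refine (norm_add_le _ _).trans ?_
    have : ‖trunc n (a ζ)‖ < ε' := hk2
    linarith
  have hwd : |‖w‖ - d| ≤ 3 * ε' := by
    have h1 := abs_norm_sub_norm_le (a ζ) w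
    have h2 : |‖a ζ‖ - d| < ε' := hk1
    rw [abs_le] at h1 ⊢
    rw [abs_lt] at h2
    constructor <;> linarith [h1.1, h1.2, h2.1, h2.2]
  have hw0 : 0 < ‖w‖ := by linarith [(abs_le.1 hwd).1]
  have hw0' : (‖w‖ : ℂ) ≠ 0 := by exact_mod_cast hw0.ne'
  refine ⟨m, (le_max_right _ _).trans hm2, ζ, ((‖w‖⁻¹ : ℝ) : ℂ) • w,
    hq.mono le_rfl ((le_max_left _ _).trans hm2),
    (suppIn_trunc_sub_trunc _ ((le_max_right _ _).trans hm2)).smul _, hζ1, ?_, ?_⟩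
  · rw [norm_smul]
    simp [hw0.ne']
  · have h1 : a ζ - (d : ℂ) • ((‖w‖⁻¹ : ℝ) : ℂ) • w
        = (a ζ - w) + ((‖w‖ - d : ℝ) : ℂ) • ((‖w‖⁻¹ : ℝ) : ℂ) • w := by
      rw [Complex.ofReal_sub, sub_smul, smul_smul (‖w‖ : ℂ), Complex.ofReal_inv,
        mul_inv_cancel₀ hw0', one_smul]
      abel
    rw [h1]
    refine (norm_add_le _ _).trans ?_
    rw [norm_smul, norm_smul, Complex.norm_real, Complex.norm_real, norm_inv, norm_norm,
      inv_mul_cancel₀ hw0.ne', mul_one, Real.norm_eq_abs]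
    linarith

/-- For a unit vector, `‖a* v‖² = ⟪a a* v, v⟫ ≤ ‖a a* v‖`, and `a a*` is compact. -/
theorem isCompactOperator_adjoint {a : EllTwo →L[ℂ] EllTwo} (ha : IsCompactOperator a) :
    IsCompactOperator a.adjoint := by
  rw [isCompactOperator_iff_tendsto]
  have h := isCompactOperator_iff_tendsto.1 (show IsCompactOperator (a * a.adjoint) from
    ha.comp_clm a.adjoint)
  have h2 : Tendsto (fun v => √‖(a * a.adjoint) v‖) (vecFilter ∅) (𝓝 0) := by
    simpa [Function.comp_def] using (Real.continuous_sqrt.tendsto _).comp h.norm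
  refine squeeze_zero_norm' ((vecFilter_tailUnit ∅ 0).mono fun v hv => Real.le_sqrt_of_sq_le ?_) h2
  rw [ContinuousLinearMap.apply_norm_sq_eq_inner_adjoint_left, ContinuousLinearMap.adjoint_adjoint]
  refine (re_inner_le_norm _ _).trans ?_
  rw [hv.1, mul_one]
  rfl

/-- The supports alternate: `ξ i`, then `ζ i` and `η i` together, then `ξ (i + 1)`. Thus a
triangular operator can send `ξ (i + 1)` to `ζ i`, and another can send `η i` to `ξ i`. -/
theorem exists_interlaced_blocks {a : EllTwo →L[ℂ] EllTwo} (ha : ¬ IsCompactOperator a)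
    {S : Set (EllTwo →L[ℂ] EllTwo)} (hS : S.Countable) (hne : (vecFilter S).NeBot) :
    ∃ (d : ℂ) (p q : ℕ → ℕ) (ξ ζ η : ℕ → EllTwo), d ≠ 0 ∧ (∀ i, p i ≤ q i) ∧
      (∀ i, q i ≤ p (i + 1)) ∧ (∀ i, SuppIn (ξ i) (p i) (q i)) ∧
      (∀ i, SuppIn (ζ i) (q i) (p (i + 1))) ∧ (∀ i, SuppIn (η i) (q i) (p (i + 1))) ∧
      (∀ i, ‖ξ i‖ = 1) ∧ (∀ i, ‖ζ i‖ = 1) ∧ (∀ i, ‖η i‖ = 1) ∧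
      Tendsto ξ atTop (vecFilter S) ∧
      Tendsto (fun i => a (ζ i) - d • η i) atTop (𝓝 0) := by
  obtain ⟨d, hd, hpair⟩ := exists_unit_pair_of_not_isCompactOperator ha
  have := isCountablyGenerated_vecFilter hS
  obtain ⟨U, hU⟩ := (vecFilter S).exists_antitone_basis
  have hξ : ∀ i n, ∃ m, n ≤ m ∧ ∃ ξ, ξ ∈ U i ∧ ‖ξ‖ = 1 ∧ SuppIn ξ n m := by
    intro i n
    obtain ⟨ξ, h1, h2, m, hm⟩ := (Filter.Eventually.and (hU.mem i) (vecFilter_tailUnit S n)).exists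
    exact ⟨max n m, le_max_left _ _, ξ, h1, h2, hm.mono le_rfl (le_max_right _ _)⟩
  choose Q hQ X hXU hX1 hX using hξ
  choose M hM Z Y hZ hY hZ1 hY1 hZY using hpair
  have hpos : ∀ i : ℕ, (0 : ℝ) < 1 / (i + 1) := fun i => by positivity
  let p : ℕ → ℕ := fun i => Nat.rec 0 (fun i n => M (1 / ((i : ℝ) + 1)) (hpos i) (Q i n)) i
  refine ⟨(d : ℂ), p, fun i => Q i (p i), fun i => X i (p i),
    fun i => Z (1 / ((i : ℝ) + 1)) (hpos i) (Q i (p i)),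
    fun i => Y (1 / ((i : ℝ) + 1)) (hpos i) (Q i (p i)), by exact_mod_cast hd.ne', fun i => hQ _ _,
    fun i => hM _ _ _, fun i => hX _ _, fun i => hZ _ _ _, fun i => hY _ _ _, fun i => hX1 _ _,
    fun i => hZ1 _ _ _, fun i => hY1 _ _ _, hU.tendsto fun i => hXU _ _, ?_⟩
  exact squeeze_zero_norm (fun i => hZY _ _ _) tendsto_one_div_add_atTop_nhds_zero_nat

/-! ### Adding one operator to `S`. -/

/-- Averages over long blocks of a sequence that is moved by one step are almost fixed. -/
theorem vecFilter_insert_neBot {S : Set (EllTwo →L[ℂ] EllTwo)} (hS : S.Countable)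
    {ξ : ℕ → EllTwo} (hξ : Orthonormal ℂ ξ) (hξS : Tendsto ξ atTop (vecFilter S))
    {b : EllTwo →L[ℂ] EllTwo}
    (hb : Tendsto (fun i => b (ξ (i + 1)) - ξ i) atTop (𝓝 0) ∨
      Tendsto (fun i => b (ξ i) - ξ (i + 1)) atTop (𝓝 0)) :
    (vecFilter (insert (1 - b) S)).NeBot := by
  have hξS' := tendsto_vecFilter_iff.1 hξS
  let v : ℕ → ℕ → EllTwo := fun N M =>
    (((√(N + 1))⁻¹ : ℝ) : ℂ) • ∑ i ∈ Finset.range (N + 1), ξ (i + M)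
  have hshift : ∀ i : ℕ, Tendsto (fun M => i + M) atTop atTop := fun i =>
    tendsto_atTop_mono (fun M => Nat.le_add_left M i) tendsto_id
  have hv1 : ∀ N M, ‖v N M‖ = 1 := by
    intro N M
    have h1 : ‖∑ i ∈ Finset.range (N + 1), ξ (i + M)‖ = √(N + 1) := by
      have h2 := (hξ.comp (fun i => i + M) (add_left_injective M)).inner_sum
        (fun _ => 1) (fun _ => 1) (Finset.range (N + 1))
      simp only [one_smul, inner_self_eq_norm_sq_to_K, Function.comp_apply] at h2
      rw [← Real.sqrt_sq (norm_nonneg _)]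
      congr 1
      have h3 : ((‖∑ i ∈ Finset.range (N + 1), ξ (i + M)‖ ^ 2 : ℝ) : ℂ) = ((N + 1 : ℝ) : ℂ) := by
        push_cast
        simpa using h2
      exact_mod_cast h3
    rw [norm_smul, h1, Complex.norm_real, norm_inv, Real.norm_of_nonneg (Real.sqrt_nonneg _),
      inv_mul_cancel₀ (by positivity)]
  have hvS : ∀ N, Tendsto (v N) atTop (vecFilter S) := by
    intro N
    refine tendsto_vecFilter_iff.2 ⟨fun n => ?_, fun s hs => ?_⟩
    · have h1 : ∀ i ∈ Finset.range (N + 1), ∀ᶠ M in atTop, ξ (i + M) ∈ tailUnit n :=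
        fun i _ => (hshift i).eventually (hξS'.1 n)
      refine ((Finset.eventually_all _).2 h1).mono fun M hM => ⟨hv1 N M, ?_⟩
      choose! m hm using fun i hi => (hM i hi).2
      refine ⟨(Finset.range (N + 1)).sup m, SuppIn.smul (SuppIn.sum fun i hi => ?_) _⟩
      exact (hm i hi).mono le_rfl (Finset.le_sup hi)
    · have h1 : Tendsto (fun M => ∑ i ∈ Finset.range (N + 1), s (ξ (i + M))) atTop (𝓝 0) := by
        simpa using tendsto_finsetSum (Finset.range (N + 1))
          fun i _ => (hξS'.2 s hs).comp (hshift i)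
      simpa [v] using h1.const_smul (((√(N + 1))⁻¹ : ℝ) : ℂ)
  -- The bound does not depend on `N`: at most 2 from the telescoping sum and less than 1 from the
  -- error. The factor `1 / √(N + 1)` in `v` then makes it small.
  have hsum : ∀ N : ℕ, ∀ᶠ M in atTop,
      ‖∑ i ∈ Finset.range (N + 1), (1 - b) (ξ (i + M))‖ < 3 := by
    intro N
    have herr : ∀ {e : ℕ → EllTwo}, Tendsto e atTop (𝓝 0) →
        ∀ᶠ M in atTop, ‖∑ i ∈ Finset.range (N + 1), e (i + M)‖ < 1 := by
      intro e he
      have h1 : Tendsto (fun M => ∑ i ∈ Finset.range (N + 1), e (i + M)) atTop (𝓝 0) := by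
        simpa using tendsto_finsetSum (Finset.range (N + 1)) fun i _ => he.comp (hshift i)
      simpa using h1.eventually (Metric.ball_mem_nhds 0 one_pos)
    have htel : ∀ M, ‖∑ i ∈ Finset.range (N + 1), (ξ (i + 1 + M) - ξ (i + M))‖ ≤ 2 := by
      intro M
      rw [Finset.sum_range_sub (fun i => ξ (i + M))]
      refine (norm_sub_le _ _).trans ?_
      rw [hξ.1, hξ.1]
      norm_num
    rcases hb with hb | hb
    -- A backward shift controls `b` only on `ξ (i + 1)`, so the run is started at `M + 1`.
    · rw [← map_add_atTop_eq_nat 1, eventually_map]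
      refine (herr hb).mono fun M hM => ?_
      have h1 : ∑ i ∈ Finset.range (N + 1), (1 - b) (ξ (i + (M + 1)))
          = ∑ i ∈ Finset.range (N + 1), (ξ (i + 1 + M) - ξ (i + M))
            - ∑ i ∈ Finset.range (N + 1), (b (ξ (i + M + 1)) - ξ (i + M)) := by
        rw [← Finset.sum_sub_distrib]
        refine Finset.sum_congr rfl fun i _ => ?_
        rw [show i + (M + 1) = i + M + 1 by ring, show i + 1 + M = i + M + 1 by ring]
        simp
      rw [h1]
      linarith [norm_sub_le (∑ i ∈ Finset.range (N + 1), (ξ (i + 1 + M) - ξ (i + M)))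
        (∑ i ∈ Finset.range (N + 1), (b (ξ (i + M + 1)) - ξ (i + M))), htel M]
    · refine (herr hb).mono fun M hM => ?_
      have h1 : ∑ i ∈ Finset.range (N + 1), (1 - b) (ξ (i + M))
          = - (∑ i ∈ Finset.range (N + 1), (ξ (i + 1 + M) - ξ (i + M))
            + ∑ i ∈ Finset.range (N + 1), (b (ξ (i + M)) - ξ (i + M + 1))) := by
        rw [← Finset.sum_add_distrib, ← Finset.sum_neg_distrib]
        refine Finset.sum_congr rfl fun i _ => ?_
        rw [show i + 1 + M = i + M + 1 by ring]
        simp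
      rw [h1, norm_neg]
      linarith [norm_add_le (∑ i ∈ Finset.range (N + 1), (ξ (i + 1 + M) - ξ (i + M)))
        (∑ i ∈ Finset.range (N + 1), (b (ξ (i + M)) - ξ (i + M + 1))), htel M]
  have := isCountablyGenerated_vecFilter hS
  obtain ⟨U, hU⟩ := (vecFilter S).exists_antitone_basis
  have hex : ∀ N, ∃ M, v N M ∈ U N ∧ ‖(1 - b) (v N M)‖ ≤ 3 * √(1 / (N + 1)) := by
    intro N
    obtain ⟨M, hM1, hM2⟩ := (((hvS N).eventually (hU.mem N)).and (hsum N)).exists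
    refine ⟨M, hM1, ?_⟩
    rw [map_smul, map_sum, norm_smul, Complex.norm_real, norm_inv,
      Real.norm_of_nonneg (Real.sqrt_nonneg _), one_div, Real.sqrt_inv, mul_comm]
    gcongr
  choose M hMU hMb using hex
  have hlim : Tendsto (fun N => v N (M N)) atTop (vecFilter S) := hU.tendsto hMU
  have hlim' : Tendsto (fun N => v N (M N)) atTop (vecFilter (insert (1 - b) S)) := by
    refine tendsto_vecFilter_iff.2 ⟨(tendsto_vecFilter_iff.1 hlim).1, ?_⟩
    rintro s (rfl | hs)
    · refine squeeze_zero_norm hMb ?_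
      have h0 := ((Real.continuous_sqrt.tendsto 0).comp
        tendsto_one_div_add_atTop_nhds_zero_nat).const_mul 3
      simpa [Function.comp_def] using h0
    · exact (tendsto_vecFilter_iff.1 hlim).2 s hs
  exact hlim'.neBot

/-- The hypothesis on `vecFilter S` survives when `S` is enlarged by an element `1 - x * a * y`
with `x`, `y` upper triangular. -/
theorem exists_insert_neBot {a : EllTwo →L[ℂ] EllTwo} (ha : ¬ IsCompactOperator a)
    {S : Set (EllTwo →L[ℂ] EllTwo)} (hS : S.Countable) (hne : (vecFilter S).NeBot) :
    ∃ x ∈ upperTriangular, ∃ y ∈ upperTriangular,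
      (vecFilter (insert (1 - x * a * y) S)).NeBot := by
  obtain ⟨d, p, q, ξ, ζ, η, hd, hpq, hqp, hξ, hζ, hη, hξ1, hζ1, hη1, hlim, ha⟩ :=
    exists_interlaced_blocks ha hS hne
  have hp : Monotone p := monotone_nat_of_le_succ fun i => (hpq i).trans (hqp i)
  have hξo := SuppIn.orthonormal hξ (fun i j hij => (hqp i).trans (hp hij)) hξ1
  have hζo := SuppIn.orthonormal hζ (fun i j hij => (hp hij).trans (hpq j)) hζ1
  have hηo := SuppIn.orthonormal hη (fun i j hij => (hp hij).trans (hpq j)) hη1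
  have hξo' := hξo.comp _ (add_left_injective 1)
  -- Along `ξ (i + 1) ↦ ζ i ↦ d • η i ↦ d • ξ i`, with the middle arrow approximate, `y` and `x`
  -- move supports only to the left.
  obtain ⟨y, hy, hy'⟩ := exists_partialIsometry hξo' hζo
  obtain ⟨x, hx, hx'⟩ := exists_partialIsometry hηo hξo
  refine ⟨d⁻¹ • x, Subalgebra.smul_mem _ (mem_upperTriangular_of_apply_eq_zero
    fun k i hki => hx' i k fun j => (hη j).eq_zero_or (hξ j) le_rfl hki) _,
    y, mem_upperTriangular_of_apply_eq_zero
    fun k i hki => hy' i k fun j => (hξ (j + 1)).eq_zero_or (hζ j) le_rfl hki, ?_⟩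
  refine vecFilter_insert_neBot hS hξo hlim (Or.inl ?_)
  have h1 := (((d⁻¹ • x).continuous.tendsto 0).comp ha)
  rw [map_zero] at h1
  refine h1.congr fun i => ?_
  have hyi : y (ξ (i + 1)) = ζ i := hy i
  simp [hyi, hx, hd, smul_sub]

/-- The partial isometries now move blocks to the right, so that their adjoints are upper
triangular; the composite with `a*` is an approximate forward shift. -/
theorem exists_insert_adjoint_neBot {a : EllTwo →L[ℂ] EllTwo} (ha : ¬ IsCompactOperator a)
    {S : Set (EllTwo →L[ℂ] EllTwo)} (hS : S.Countable) (hne : (vecFilter S).NeBot) :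
    ∃ x ∈ upperTriangular, ∃ y ∈ upperTriangular,
      (vecFilter (insert (star (1 - x * a * y)) S)).NeBot := by
  have ha' : ¬ IsCompactOperator a.adjoint := fun h => ha (by
    simpa using isCompactOperator_adjoint h)
  obtain ⟨d, p, q, ξ, ζ, η, hd, hpq, hqp, hξ, hζ, hη, hξ1, hζ1, hη1, hlim, ha⟩ :=
    exists_interlaced_blocks ha' hS hne
  have hp : Monotone p := monotone_nat_of_le_succ fun i => (hpq i).trans (hqp i)
  have hξo := SuppIn.orthonormal hξ (fun i j hij => (hqp i).trans (hp hij)) hξ1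
  have hζo := SuppIn.orthonormal hζ (fun i j hij => (hp hij).trans (hpq j)) hζ1
  have hηo := SuppIn.orthonormal hη (fun i j hij => (hp hij).trans (hpq j)) hη1
  have hξo' := hξo.comp _ (add_left_injective 1)
  obtain ⟨x, hx, hx'⟩ := exists_partialIsometry hξo hζo
  obtain ⟨y, hy, hy'⟩ := exists_partialIsometry hηo hξo'
  refine ⟨star x, mem_upperTriangular_of_apply_eq_zero fun k i hki => ?_,
    star (d⁻¹ • y), mem_upperTriangular_of_apply_eq_zero fun k i hki => ?_, ?_⟩
  · rw [ContinuousLinearMap.star_eq_adjoint, adjoint_stdVec_apply, hx' k i, map_zero]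
    exact fun j => ((hζ j).eq_zero_or (hξ j) le_rfl hki).symm
  · rw [ContinuousLinearMap.star_eq_adjoint, adjoint_stdVec_apply, smul_apply, lp.coeFn_smul,
      Pi.smul_apply, hy' k i, smul_zero, map_zero]
    exact fun j => ((hξ (j + 1)).eq_zero_or (hη j) le_rfl hki).symm
  have heq : star (1 - star x * a * star (d⁻¹ • y))
      = 1 - d⁻¹ • y * star a * x := by
    simp [mul_assoc]
  rw [heq, ContinuousLinearMap.star_eq_adjoint]
  refine vecFilter_insert_neBot hS hξo hlim (Or.inr ?_)
  have h1 := (((d⁻¹ • y).continuous.tendsto 0).comp ha)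
  rw [map_zero] at h1
  refine h1.congr fun i => ?_
  have hyi : y (η i) = ξ (i + 1) := hy i
  simp [hyi, hx, hd, smul_sub]

/-! ### Transfinite recursion of length at most `ω₁`. -/

/-- In a well-order of minimal type every proper initial segment of `α` is countable, so `hstep`
applies at each stage; finite character carries `P` through limit stages. -/
theorem exists_set_of_countable_extension {α X : Type} (hα : #α ≤ ℵ₁) {P : Set X → Prop}
    {Q : α → X → Prop} (hempty : P ∅) (hanti : ∀ S S', S ⊆ S' → P S' → P S)
    (hfin : ∀ S, (∀ F ⊆ S, F.Finite → P F) → P S)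
    (hstep : ∀ S, S.Countable → P S → ∀ a, ∃ l, Q a l ∧ P (insert l S)) :
    ∃ S, P S ∧ ∀ a, ∃ l ∈ S, Q a l := by
  rcases isEmpty_or_nonempty α with hαe | ⟨⟨a₀⟩⟩
  · exact ⟨∅, hempty, fun a => (hαe.false a).elim⟩
  have hX : Nonempty X := ⟨(hstep ∅ Set.countable_empty hempty a₀).choose⟩
  obtain ⟨_, hwf, hord⟩ := Cardinal.exists_ord_eq_type_lt α
  have hcount : ∀ a : α, (Set.Iio a).Countable := fun a =>
    Cardinal.le_aleph0_iff_set_countable.1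
      (Cardinal.lt_aleph_one_iff.1 ((Cardinal.mk_Iio_lt a hord).trans_le hα))
  -- `Classical.epsilon` lets `f` be defined before a suitable choice is known to exist; `hspec`
  -- supplies existence by induction.
  let f : α → X := hwf.wf.fix fun a g =>
    Classical.epsilon fun l => Q a l ∧ P (insert l (Set.range fun b : Set.Iio a => g b b.2))
  have hf : ∀ a, f a = Classical.epsilon fun l => Q a l ∧ P (insert l (f '' Set.Iio a)) := by
    intro a
    refine (hwf.wf.fix_eq _ a).trans ?_
    rw [Set.image_eq_range]
  have hunion : ∀ B : Set α, (∀ b ∈ B, P (insert (f b) (f '' Set.Iio b))) → P (f '' B) := by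
    intro B hB
    refine hfin _ fun F hF hFfin => ?_
    obtain ⟨G, hGB, hGfin, hGF⟩ := Set.exists_subset_image_finite_and.1
      (⟨F, hF, hFfin, rfl⟩ : ∃ t ⊆ f '' B, t.Finite ∧ t = F)
    rw [← hGF]
    rcases G.eq_empty_or_nonempty with rfl | hne
    · simpa using hempty
    -- The values on a finite set of indices all lie in the stage of its largest index `b`.
    obtain ⟨b, hb, hmax⟩ := hGfin.exists_maximalFor id G hne
    refine hanti _ _ ?_ (hB b (hGB hb))
    rintro _ ⟨c, hc, rfl⟩
    rcases lt_trichotomy c b with h | rfl | h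
    · exact Or.inr ⟨c, h, rfl⟩
    · exact Or.inl rfl
    · exact absurd (hmax hc h.le) h.not_ge
  have hspec : ∀ a, Q a (f a) ∧ P (insert (f a) (f '' Set.Iio a)) := by
    intro a
    induction a using hwf.wf.induction with
    | _ a ih =>
      rw [hf a]
      exact Classical.epsilon_spec (hstep _ ((hcount a).image f)
        (hunion _ fun b hb => (ih b hb).2) a)
  exact ⟨f '' Set.univ, hunion _ fun b _ => (hspec b).2, fun a => ⟨f a, ⟨a, trivial, rfl⟩,
    (hspec a).1⟩⟩

/-- A bounded operator is determined by its matrix, an element of `ℂ ^ (ℕ × ℕ)`. -/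
theorem mk_operators_le : #(EllTwo →L[ℂ] EllTwo) ≤ 𝔠 := by
  have hinj : Function.Injective
      fun (T : EllTwo →L[ℂ] EllTwo) (p : ℕ × ℕ) => T (stdVec p.1) p.2 := by
    intro T T' h
    have hb : ∀ k, T (stdVec k) = T' (stdVec k) := fun k => by
      ext i
      exact congrFun h (k, i)
    ext1 v
    have h1 : ∀ n, T (trunc n v) = T' (trunc n v) := fun n => by
      simp [trunc_eq_sum, hb]
    refine tendsto_nhds_unique ((T.continuous.tendsto _).comp (tendsto_trunc v)) ?_
    exact (((T'.continuous.tendsto _).comp (tendsto_trunc v))).congr fun n => (h1 n).symm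
  refine (mk_le_of_injective hinj).trans ?_
  simp [Cardinal.mk_complex]

/-! ### From one-sided ideals to primitivity. -/

section Algebra

variable {R : Type u} [Ring R]

/-- A proper left ideal `L` containing an ideal `J` and, for each `a ∉ J`, an element
`1 - x * a * y`, is contained in a maximal left ideal `m` such that `J` is the annihilator
of `R ⧸ m`. -/
theorem exists_simple_module_annihilator {J : Set R} {L : Ideal R} (hL : (1 : R) ∉ L)
    (hJ : ∀ r ∈ J, ∀ s, r * s ∈ L) (hLJ : ∀ a ∉ J, ∃ x y, 1 - x * a * y ∈ L) :
    ∃ (M : Type u) (_ : AddCommGroup M) (_ : Module R M),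
      IsSimpleModule R M ∧ ∀ r : R, r ∈ J ↔ ∀ z : M, r • z = 0 := by
  obtain ⟨m, hm, hLm⟩ := L.exists_le_maximal ((Ideal.ne_top_iff_one L).2 hL)
  refine ⟨R ⧸ m, inferInstance, inferInstance, isSimpleModule_iff_isCoatom.2 hm.out, fun r => ⟨?_, ?_⟩⟩
  · rintro hr ⟨s⟩
    exact (Submodule.Quotient.mk_eq_zero m).2 (hLm (hJ r hr s))
  · intro h
    by_contra hr
    obtain ⟨x, y, hxy⟩ := hLJ r hr
    have h1 : r * y ∈ m := (Submodule.Quotient.mk_eq_zero m).1 (h (Submodule.Quotient.mk y))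
    have h2 : x * r * y ∈ m := by
      rw [mul_assoc]
      exact m.mul_mem_left x h1
    exact (Ideal.ne_top_iff_one m).1 hm.ne_top (by simpa using m.add_mem (hLm hxy) h2)

theorem isLeftPrimitiveIdeal_of_leftIdeal {I : Ideal R} {L : Ideal R} [I.IsTwoSided]
    (hL : (1 : R) ∉ L) (hI : I ≤ L) (hLI : ∀ a ∉ I, ∃ x y, 1 - x * a * y ∈ L) :
    IsLeftPrimitiveIdeal I :=
  exists_simple_module_annihilator (J := (I : Set R)) hL
    (fun _ hr s => hI (I.mul_mem_right s hr)) hLI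

theorem isRightPrimitiveIdeal_of_rightIdeal {I : Ideal R} {L : Ideal Rᵐᵒᵖ}
    (hL : (1 : Rᵐᵒᵖ) ∉ L) (hI : ∀ r ∈ I, MulOpposite.op r ∈ L)
    (hLI : ∀ a ∉ I, ∃ x y, MulOpposite.op (1 - x * a * y) ∈ L) :
    IsRightPrimitiveIdeal I := by
  obtain ⟨M, i1, i2, hM, h⟩ := exists_simple_module_annihilator
    (J := MulOpposite.unop ⁻¹' (I : Set R)) hL
    (fun r hr s => by
      have : MulOpposite.op (s.unop * r.unop) ∈ L := hI _ (I.mul_mem_left _ hr)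
      simpa using this)
    (fun a ha => by
      obtain ⟨x, y, hxy⟩ := hLI a.unop ha
      exact ⟨MulOpposite.op y, MulOpposite.op x, by simpa [mul_assoc] using hxy⟩)
  exact ⟨M, i1, i2, hM, fun r => h (MulOpposite.op r)⟩

theorem IsLeftPrimitiveIdeal.isLeftPrimitiveRing (h : IsLeftPrimitiveIdeal (⊥ : Ideal R)) :
    IsLeftPrimitiveRing R := by
  obtain ⟨M, i1, i2, hM, h⟩ := h
  refine ⟨M, i1, i2, hM, ⟨fun {r s} hrs => sub_eq_zero.1 ?_⟩⟩
  exact (h _).2 fun m => by rw [sub_smul, hrs, sub_self]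

theorem IsRightPrimitiveIdeal.isRightPrimitiveRing (h : IsRightPrimitiveIdeal (⊥ : Ideal R)) :
    IsRightPrimitiveRing R := by
  obtain ⟨M, i1, i2, hM, h⟩ := h
  refine ⟨M, i1, i2, hM, ⟨fun {r s} hrs => MulOpposite.unop_injective (sub_eq_zero.1 ?_)⟩⟩
  exact (h _).2 fun m => by simp [sub_smul, hrs]

theorem isLeftPrimitiveRing_quotient {I : Ideal R} {L : Ideal R} [I.IsTwoSided]
    (hL : (1 : R) ∉ L) (hI : I ≤ L) (hLI : ∀ a ∉ I, ∃ x y, 1 - x * a * y ∈ L) :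
    IsLeftPrimitiveRing (R ⧸ I) := by
  refine (isLeftPrimitiveIdeal_of_leftIdeal (L := L.map (Ideal.Quotient.mk I)) ?_ bot_le
    ?_).isLeftPrimitiveRing
  · intro h1
    obtain ⟨r, hr, hr1⟩ := (Ideal.mem_map_iff_of_surjective _ Ideal.Quotient.mk_surjective).1 h1
    -- Since `I ≤ L`, an element of `L` congruent to `1` modulo `I` would put `1` in `L`.
    have h2 : r - 1 ∈ I := Ideal.Quotient.eq.1 (by rw [hr1, map_one])
    exact hL (by simpa using L.sub_mem hr (hI h2))
  · intro a ha
    obtain ⟨a, rfl⟩ := Ideal.Quotient.mk_surjective a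
    obtain ⟨x, y, hxy⟩ := hLI a fun h => ha (Ideal.Quotient.eq_zero_iff_mem.2 h)
    exact ⟨Ideal.Quotient.mk I x, Ideal.Quotient.mk I y,
      by simpa using Ideal.mem_map_of_mem (Ideal.Quotient.mk I) hxy⟩

theorem isRightPrimitiveRing_quotient {I : Ideal R} {L : Ideal Rᵐᵒᵖ} [I.IsTwoSided]
    (hL : (1 : Rᵐᵒᵖ) ∉ L) (hI : ∀ r ∈ I, MulOpposite.op r ∈ L)
    (hLI : ∀ a ∉ I, ∃ x y, MulOpposite.op (1 - x * a * y) ∈ L) :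
    IsRightPrimitiveRing (R ⧸ I) := by
  have hsurj : Function.Surjective (Ideal.Quotient.mk I).op := fun z => by
    obtain ⟨a, ha⟩ := Ideal.Quotient.mk_surjective z.unop
    exact ⟨MulOpposite.op a, MulOpposite.unop_injective ha⟩
  refine (isRightPrimitiveIdeal_of_rightIdeal (L := L.map (Ideal.Quotient.mk I).op) ?_ ?_
    ?_).isRightPrimitiveRing
  · intro h1
    obtain ⟨r, hr, hr1⟩ := (Ideal.mem_map_iff_of_surjective _ hsurj).1 h1
    have h2 : r.unop - 1 ∈ I := Ideal.Quotient.eq.1 (by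
      rw [map_one]
      exact congrArg MulOpposite.unop hr1)
    exact hL (by simpa using L.sub_mem hr (hI _ h2))
  · rintro r rfl
    exact Ideal.zero_mem _
  · intro a ha
    obtain ⟨a, rfl⟩ := Ideal.Quotient.mk_surjective a
    obtain ⟨x, y, hxy⟩ := hLI a fun h => ha (Ideal.Quotient.eq_zero_iff_mem.2 h)
    exact ⟨Ideal.Quotient.mk I x, Ideal.Quotient.mk I y,
      by simpa using Ideal.mem_map_of_mem (Ideal.Quotient.mk I).op hxy⟩

end Algebra

/-! ### The vanishing ideals and the conclusion. -/

variable {A : Subalgebra ℂ (EllTwo →L[ℂ] EllTwo)}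

/-- The left ideal of the operators in `A` that tend to zero along `vecFilter S`. -/
noncomputable def vanishingLeftIdeal (A : Subalgebra ℂ (EllTwo →L[ℂ] EllTwo))
    (S : Set (EllTwo →L[ℂ] EllTwo)) : Ideal A where
  carrier := {r | Tendsto (fun v => (r : EllTwo →L[ℂ] EllTwo) v) (vecFilter S) (𝓝 0)}
  add_mem' := fun hr hs => by simpa using Tendsto.add hr hs
  zero_mem' := by simpa using tendsto_const_nhds
  smul_mem' := fun c r hr => by
    have := ((c : EllTwo →L[ℂ] EllTwo).continuous.tendsto 0).comp hr
    rwa [map_zero] at this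

/-- The right ideal of the operators in `A` whose adjoints tend to zero along `vecFilter S`. -/
noncomputable def vanishingRightIdeal (A : Subalgebra ℂ (EllTwo →L[ℂ] EllTwo))
    (S : Set (EllTwo →L[ℂ] EllTwo)) : Ideal Aᵐᵒᵖ where
  carrier := {r | Tendsto (fun v => (star (r.unop : EllTwo →L[ℂ] EllTwo)) v) (vecFilter S) (𝓝 0)}
  add_mem' := fun hr hs => by simpa using Tendsto.add hr hs
  zero_mem' := by simpa using tendsto_const_nhds
  smul_mem' := fun c r hr => by
    have := ((star (c.unop : EllTwo →L[ℂ] EllTwo)).continuous.tendsto 0).comp hr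
    rw [map_zero] at this
    simpa [Function.comp_def] using this

theorem not_tendsto_one_vecFilter {S : Set (EllTwo →L[ℂ] EllTwo)} (hS : (vecFilter S).NeBot) :
    ¬ Tendsto (fun v => (1 : EllTwo →L[ℂ] EllTwo) v) (vecFilter S) (𝓝 0) := by
  intro h
  have h1 : Tendsto (fun v : EllTwo => ‖v‖) (vecFilter S) (𝓝 0) := by simpa using h.norm
  have h2 : Tendsto (fun v : EllTwo => ‖v‖) (vecFilter S) (𝓝 1) :=
    tendsto_const_nhds.congr' ((vecFilter_tailUnit S 0).mono fun v hv => hv.1.symm)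
  exact zero_ne_one (tendsto_nhds_unique h1 h2)

/-- As `x` and `y` are upper triangular, they lie in any `A` above `upperTriangular`; one argument
thus covers both algebras. -/
theorem exists_leftIdeal (CH : (ℵ₁ : Cardinal.{0}) = 𝔠) (hA : upperTriangular ≤ A) :
    ∃ L : Ideal A, 1 ∉ L ∧ compactIdeal A ≤ L ∧
      ∀ a ∉ compactIdeal A, ∃ x y, 1 - x * a * y ∈ L := by
  obtain ⟨S, hS, hSa⟩ := exists_set_of_countable_extension
    (α := {a : EllTwo →L[ℂ] EllTwo // ¬ IsCompactOperator a})
    (P := fun S => (vecFilter S).NeBot)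
    (Q := fun a l => ∃ x ∈ upperTriangular, ∃ y ∈ upperTriangular, l = 1 - x * a * y)
    ((mk_subtype_le _).trans (mk_operators_le.trans CH.ge)) vecFilter_empty_neBot
    (fun S S' h h' => h'.mono (vecFilter_anti h)) (fun S => vecFilter_neBot_of_finite)
    (fun S hS hP a => by
      obtain ⟨x, hx, y, hy, h⟩ := exists_insert_neBot a.2 hS hP
      exact ⟨_, ⟨x, hx, y, hy, rfl⟩, h⟩)
  refine ⟨vanishingLeftIdeal A S, not_tendsto_one_vecFilter hS, fun r hr => ?_, fun a ha => ?_⟩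
  · exact (isCompactOperator_iff_tendsto.1 hr).mono_left (vecFilter_anti (Set.empty_subset S))
  · obtain ⟨l, hl, x, hx, y, hy, rfl⟩ := hSa ⟨a, ha⟩
    exact ⟨⟨x, hA hx⟩, ⟨y, hA hy⟩, tendsto_apply_vecFilter hl⟩

theorem exists_rightIdeal (CH : (ℵ₁ : Cardinal.{0}) = 𝔠) (hA : upperTriangular ≤ A) :
    ∃ L : Ideal Aᵐᵒᵖ, 1 ∉ L ∧ (∀ r ∈ compactIdeal A, MulOpposite.op r ∈ L) ∧
      ∀ a ∉ compactIdeal A, ∃ x y, MulOpposite.op (1 - x * a * y) ∈ L := by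
  obtain ⟨S, hS, hSa⟩ := exists_set_of_countable_extension
    (α := {a : EllTwo →L[ℂ] EllTwo // ¬ IsCompactOperator a})
    (P := fun S => (vecFilter S).NeBot)
    (Q := fun a l => ∃ x ∈ upperTriangular, ∃ y ∈ upperTriangular, l = star (1 - x * a * y))
    ((mk_subtype_le _).trans (mk_operators_le.trans CH.ge)) vecFilter_empty_neBot
    (fun S S' h h' => h'.mono (vecFilter_anti h)) (fun S => vecFilter_neBot_of_finite)
    (fun S hS hP a => by
      obtain ⟨x, hx, y, hy, h⟩ := exists_insert_adjoint_neBot a.2 hS hP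
      exact ⟨_, ⟨x, hx, y, hy, rfl⟩, h⟩)
  refine ⟨vanishingRightIdeal A S, fun h => not_tendsto_one_vecFilter hS ?_, fun r hr => ?_,
    fun a ha => ?_⟩
  · have h' : Tendsto (fun v => star (1 : EllTwo →L[ℂ] EllTwo) v) (vecFilter S) (𝓝 0) := h
    rwa [star_one] at h'
  · exact (isCompactOperator_iff_tendsto.1 (isCompactOperator_adjoint hr)).mono_left
      (vecFilter_anti (Set.empty_subset S))
  · obtain ⟨l, hl, x, hx, y, hy, rfl⟩ := hSa ⟨a, ha⟩
    exact ⟨⟨x, hA hx⟩, ⟨y, hA hy⟩, tendsto_apply_vecFilter hl⟩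

theorem upperTriangular_le_quasitriangular : upperTriangular ≤ quasitriangular :=
  fun T hT => ⟨T, hT, 0, isCompactOperator_zero, (add_zero T).symm⟩

theorem mainTheorem12
    (CH : (Cardinal.aleph 1 : Cardinal.{0}) = Cardinal.continuum) :
    (IsLeftPrimitiveRing (upperTriangular ⧸ compactIdeal upperTriangular) ∧
      IsRightPrimitiveRing (upperTriangular ⧸ compactIdeal upperTriangular)) ∧
    (IsLeftPrimitiveRing (quasitriangular ⧸ compactIdeal quasitriangular) ∧
      IsRightPrimitiveRing (quasitriangular ⧸ compactIdeal quasitriangular)) ∧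
    (IsLeftPrimitiveIdeal (compactIdeal quasitriangular) ∧
      IsRightPrimitiveIdeal (compactIdeal quasitriangular)) := by
  obtain ⟨L, hL1, hL2, hL3⟩ := exists_leftIdeal CH (le_refl upperTriangular)
  obtain ⟨L', hL1', hL2', hL3'⟩ := exists_rightIdeal CH (le_refl upperTriangular)
  obtain ⟨M, hM1, hM2, hM3⟩ := exists_leftIdeal CH upperTriangular_le_quasitriangular
  obtain ⟨M', hM1', hM2', hM3'⟩ := exists_rightIdeal CH upperTriangular_le_quasitriangular
  exact ⟨⟨isLeftPrimitiveRing_quotient hL1 hL2 hL3, isRightPrimitiveRing_quotient hL1' hL2' hL3'⟩,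
    ⟨isLeftPrimitiveRing_quotient hM1 hM2 hM3, isRightPrimitiveRing_quotient hM1' hM2' hM3'⟩,
    isLeftPrimitiveIdeal_of_leftIdeal hM1 hM2 hM3,
    isRightPrimitiveIdeal_of_rightIdeal hM1' hM2' hM3'⟩
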